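/- **Theorem (Front-door adjustment at a frequency).** Let $V$ be a finite set and let $(X_i)_{i\in V}$ be real stochastic processes $X_i=(X_i(t))_{t\in T}$, $T\subseteq\mathbb Z$ (for instance $T=\mathbb Z$ or $T=\{0,\dots,N-1\}$), on a common probability space $(\Theta,\mathcal M,\mathbb P)$, all of whose sample paths are absolutely summable. Fix $\omega\in[0,2\pi]$ and let $\widehat X_i(\omega)=\sum_{t\in T}X_i(t)e^{-i\omega t}$. Suppose that the random vector $(\widehat X_i(\omega))_{i\in V}\in\mathbb C^V$ has a density $f=f^{(\omega)}$ with respect to a product $\nu=\bigotimes_{i\in V}\nu_i$ of $\sigma$-finite Borel measures on $\mathbb C$, and that $f$ factorizes according to a directed acyclic graph $G=G^{(\omega)}$ on $V$: $$f(x)=\prod_{k\in V}p_k(x_k\mid x_{Pa_k})\quad\text{for $\nu$-a.e. }x,$$ where $Pa_k$ is the set of parents of $k$ in $G$, and $p_k(\cdot\mid\cdot)$ is a regular version of the conditional density of coordinate $k$ given the coordinates $Pa_k$ (that is, a jointly measurable function that is a probability density in $x_k$ for every value of $x_{Pa_k}$ and satisfies $f(x_k,x_{Pa_k})=p_k(x_k\mid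 x_{Pa_k})f(x_{Pa_k})$ a.e.). For $A,B\subseteq V$ write $f(x_A)$ for the marginal density on $A$ and $f(x_A\mid x_B)=f(x_A,x_B)/f(x_B)$. Let $W,Y,Z\subseteq V$ be pairwise disjoint, and suppose that $Z$ satisfies the front-door criterion relative to $(W,Y)$ in $G$: 1. every directed path from a node of $W$ to a node of $Y$ contains a node of $Z$; 2. every path between a node $z\in Z$ and a node of $Y$ that has an arrow into $z$ is blocked by $W$; 3. every path between a node $w\in W$ and a node of $Z$ that has an arrow into $w$ is blocked by the empty set. Here paths have distinct nodes, and a set $C$ blocks a path if the path has an inner node that either is a non-collider belonging to $C$, or is a collider such that neither it nor any of its descendants belongs to $C$. Assume moreover that $f(w,z)>0$ for $\nu$-a.e. $(w,z)$ with $f(w)>0$ and $f(z)>0$, so that the conditional densities below are defined. Define the interventional density by removing the factors of the nodes in $W$, fixing $x_W=w$, and integrating out the nodes outside $W\cup Y$: $$f^{(\omega)}(y\mid do(W=w))=\int\prod_{k\in V\setminus W}p_k(x_k\mid x_{Pa_k})\Big|_{x_W=w,\;x_Y=y}\;d\nu\big(x_{V\setminus(W\cup Y)}\big).$$ Then the causal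 effect of $W$ on $Y$ is identifiable from the density of the coordinates $W\cup Y\cup Z$: any two densities which factorize according to $G$ in the above sense and have, $\nu$-a.e., the same marginal density on $W\cup Y\cup Z$ as $f$ have the same interventional density of $Y$ given $do(W=w)$, for $\nu$-a.e. $(w,y)$ with $f(w)>0$. Moreover, for $\nu$-a.e. $(w,y)$ with $f(w)>0$, $$f^{(\omega)}\big(y\mid do(W=w)\big)=\int f^{(\omega)}(z\mid w)\int f^{(\omega)}(y\mid w',z)\,f^{(\omega)}(w')\,d\nu(w')\,d\nu(z).$$ -/

import Mathlib

open MeasureTheory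
open scoped ENNReal

/-! ### Frequency-domain representation of stochastic processes -/

/-- The discrete-time Fourier transform at frequency `ω` of the sample paths of the real processes
`X i = (X i t)_{t ∈ T}`, where the time set `T` is for instance `ℤ` or `{0, …, N - 1}`:
`θ ↦ (∑_{t ∈ T} X i t θ * exp (-i ω t))_i`. -/
noncomputable def freqVec {V Θ : Type*} {T : Set ℤ} (X : V → T → Θ → ℝ) (ω : ℝ) (θ : Θ) : V → ℂ :=
  fun i => ∑' t : T, (X i t θ : ℂ) * Complex.exp (-(Complex.I * (ω : ℂ) * ((t : ℤ) : ℂ)))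

/-! ### Directed graphs -/

/-- A directed graph without directed cycles. -/
def IsDAG {V : Type*} (G : Digraph V) : Prop :=
  ∀ v, ¬ Relation.TransGen G.Adj v v

open Classical in
/-- The set of parents of `k`. -/
noncomputable def parents {V : Type*} [Fintype V] (G : Digraph V) (k : V) : Finset V :=
  Finset.univ.filter fun j => G.Adj j k

/-- `l` lists the successive nodes of a directed path from `a` to `b`. -/
def IsDirectedPath {V : Type*} (G : Digraph V) (a b : V) (l : List V) : Prop :=
  l.IsChain G.Adj ∧ l.head? = some a ∧ l.getLast? = some b

/-- `l` lists the successive (distinct) nodes of a path from `a` to `b` in the undirected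
topology of `G`. -/
def IsUndirectedPath {V : Type*} (G : Digraph V) (a b : V) (l : List V) : Prop :=
  l.Nodup ∧ l.IsChain (fun u v => G.Adj u v ∨ G.Adj v u) ∧
    l.head? = some a ∧ l.getLast? = some b

/-- `l` is a path from `a` to `b` whose edge at `a` is an arrow into `a`. -/
def IsBackdoorPath {V : Type*} (G : Digraph V) (a b : V) (l : List V) : Prop :=
  IsUndirectedPath G a b l ∧ ∃ v l', l = a :: v :: l' ∧ G.Adj v a

/-- The set `C` blocks (d-separates) the path `l`: at some inner node `v` of the path, with
neighbours `u` and `u'` on the path, either `v` is not a collider and `v ∈ C`, or `v` is a collider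
and neither `v` nor any descendant of `v` is in `C`. -/
def Blocks {V : Type*} (G : Digraph V) (C : Finset V) (l : List V) : Prop :=
  ∃ u v u', [u, v, u'] <:+: l ∧
    ((¬ (G.Adj u v ∧ G.Adj u' v) ∧ v ∈ C) ∨
      ((G.Adj u v ∧ G.Adj u' v) ∧ ∀ d, Relation.ReflTransGen G.Adj v d → d ∉ C))

/-- The front-door criterion for `Z` relative to `(W, Y)`. -/
structure FrontDoor {V : Type*} (G : Digraph V) (W Y Z : Finset V) : Prop where
  /-- every directed path from `W` to `Y` has a node in `Z` -/
  intercepts : ∀ w ∈ W, ∀ y ∈ Y, ∀ l, IsDirectedPath G w y l → ∃ z ∈ Z, z ∈ l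
  /-- every path between `Z` and `Y` with an arrow into `Z` is blocked by `W` -/
  backdoor_ZY : ∀ z ∈ Z, ∀ y ∈ Y, ∀ l, IsBackdoorPath G z y l → Blocks G W l
  /-- every path between `W` and `Z` with an arrow into `W` is blocked by the empty set -/
  backdoor_WZ : ∀ w ∈ W, ∀ z ∈ Z, ∀ l, IsBackdoorPath G w z l → Blocks G ∅ l

/-! ### Densities

Densities of subvectors are written as functions of the whole vector `x : V → ℂ` that only
depend on the relevant coordinates. Integrating out coordinates is Mathlib's `lmarginal`. -/

section Densities

variable {V : Type*} [Fintype V] [DecidableEq V]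

/-- The marginal density `f(x_A)`: all coordinates outside `A` are integrated out. -/
noncomputable def margDensity (ν : V → Measure ℂ) (f : (V → ℂ) → ℝ≥0∞) (A : Finset V) :
    (V → ℂ) → ℝ≥0∞ :=
  lmarginal ν Aᶜ f

/-- The conditional density `f(x_A | x_B) = f(x_A, x_B) / f(x_B)`, for `f(x_B) > 0`. -/
noncomputable def condDensity (ν : V → Measure ℂ) (f : (V → ℂ) → ℝ≥0∞) (A B : Finset V) :
    (V → ℂ) → ℝ≥0∞ :=
  fun x => margDensity ν f (A ∪ B) x / margDensity ν f B x

/-- `g` is a (regular) version of the conditional density of `x_A` given `x_B`: `g(· | x_B)` is a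
probability density for every value of `x_B`, and `f(x_A, x_B) = g(x_A | x_B) f(x_B)` almost
everywhere. -/
structure IsCondDensity (ν : V → Measure ℂ) (f : (V → ℂ) → ℝ≥0∞) (A B : Finset V)
    (g : (V → ℂ) → ℝ≥0∞) : Prop where
  measurable : Measurable g
  dependsOn : DependsOn g ((A ∪ B : Finset V) : Set V)
  normalized : ∀ x, lmarginal ν A g x = 1
  disintegrates : ∀ᵐ x ∂(Measure.pi ν), margDensity ν f (A ∪ B) x = g x * margDensity ν f B x

/-- The density `f` factorizes according to `G`, `f(x) = ∏ k, p k (x_k | x_{Pa k})`, where `p k` is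
(a version of) the conditional density of node `k` given its parents. -/
structure Factorizes (ν : V → Measure ℂ) (G : Digraph V) (f : (V → ℂ) → ℝ≥0∞)
    (p : V → (V → ℂ) → ℝ≥0∞) : Prop where
  cond : ∀ k, IsCondDensity ν f {k} (parents G k) (p k)
  prod : ∀ᵐ x ∂(Measure.pi ν), f x = ∏ k, p k x

/-- The interventional density `f(y | do(W = w))` at `w = x_W`, `y = x_Y`: the factors of the nodes
of `W` are removed from the factorization, `x_W` is held at `w`, and the coordinates outside
`W ∪ Y` are integrated out. -/
noncomputable def doDensity (ν : V → Measure ℂ) (p : V → (V → ℂ) → ℝ≥0∞) (W Y : Finset V) :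
    (V → ℂ) → ℝ≥0∞ :=
  lmarginal ν (W ∪ Y)ᶜ (fun x => ∏ k ∈ Wᶜ, p k x)

/-- The front-door formula
`∫ f(z | w) (∫ f(y | w', z) f(w') dν(w')) dν(z)` at `w = x_W`, `y = x_Y`. -/
noncomputable def frontDoorFormula (ν : V → Measure ℂ) (f : (V → ℂ) → ℝ≥0∞) (W Y Z : Finset V) :
    (V → ℂ) → ℝ≥0∞ :=
  lmarginal ν Z fun x =>
    condDensity ν f Z W x *
      lmarginal ν W (fun x' => condDensity ν f Y (W ∪ Z) x' * margDensity ν f W x') x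

/-- The causal effect of `W` on `Y` is identifiable in `G` from the marginal density of `f` on the
observed nodes `O`: any two causal models over `G` which have this density on `O` have the same
interventional density of `Y` given `do(W = w)`, for almost all `(w, y)` with `f(w) > 0`. -/
def CausalEffectIdentifiable (ν : V → Measure ℂ) (G : Digraph V) (f : (V → ℂ) → ℝ≥0∞)
    (W Y O : Finset V) : Prop :=
  ∀ (f₁ f₂ : (V → ℂ) → ℝ≥0∞) (p₁ p₂ : V → (V → ℂ) → ℝ≥0∞),
    Measurable f₁ → Measurable f₂ → Factorizes ν G f₁ p₁ → Factorizes ν G f₂ p₂ →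
    (∀ᵐ x ∂(Measure.pi ν), margDensity ν f₁ O x = margDensity ν f O x) →
    (∀ᵐ x ∂(Measure.pi ν), margDensity ν f₂ O x = margDensity ν f O x) →
    ∀ᵐ x ∂(Measure.pi ν), 0 < margDensity ν f W x →
      doDensity ν p₁ W Y x = doDensity ν p₂ W Y x

end Densities

/-! A density that factorizes over `G` is a.e. the product `kernelProd p Finset.univ` of its
kernels, and for such products integrating out a sink just deletes its factor
(`lmarginal_kernelProd_union`). Observational and interventional densities can therefore be computed
inside ancestral sets. The front-door criterion then yields identities that hold at every point:

f(w,z) = f(w) f(z | do w) (`margDensity_union_eq_mul`, from condition 3); f(y | do w) = ∫ f(z | do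
w) f(y | do z) dz (`doDensity_eq_lmarginal_mul`, from conditions 1 and 2); f(w | do z) = f(w)
(`doDensity_treatment`, from condition 3); f(y,w | do z) f(w,z) = f(y,w,z) f(w)
(`doDensity_mul_margDensity`, chiefly from condition 2).

The last one integrates over w to the back-door formula f(y | do z) = ∫ f(y | w',z) f(w') dw';
inserting it and f(z | do w) = f(z | w) into the second gives the claim. Identifiability follows
because the formula only involves marginals on subsets of `W ∪ Y ∪ Z`.

The graphical input is that certain ancestral sets are disjoint, and that a separating set exists
(`exists_separating_set`). Both are shown by building an unblocked connection between two node sets.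
It is built as a trek, which may repeat nodes and so can be extended freely; `exists_nodup` turns it
into a genuine path, contradicting the criterion. -/

/-! ### Active treks and d-separation -/

section Treks

variable {V : Type*}

/-- The node `v`, with neighbours `u` and `t` on a walk, blocks the walk given `C`. -/
def BlockedAt (G : Digraph V) (C : Finset V) (u v t : V) : Prop :=
  (¬ (G.Adj u v ∧ G.Adj t v) ∧ v ∈ C) ∨
    ((G.Adj u v ∧ G.Adj t v) ∧ ∀ d, Relation.ReflTransGen G.Adj v d → d ∉ C)

/-- `l` is a walk that is not blocked by `C` and ends with an arrow into its only node in `A`.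
Nodes may be repeated. -/
inductive IsTrek (G : Digraph V) (A C : Finset V) : List V → Prop
  | base {u a : V} (hu : u ∉ A) (ha : a ∈ A) (h : G.Adj u a) : IsTrek G A C [u, a]
  | step {u v t : V} {l : List V} (hu : u ∉ A) (h : G.Adj u v ∨ G.Adj v u)
      (hb : ¬ BlockedAt G C u v t) (hl : IsTrek G A C (v :: t :: l)) :
      IsTrek G A C (u :: v :: t :: l)

/-- `v` has a directed path to `B` all of whose nodes are outside `C`. -/
def HasDirectedPathAvoiding (G : Digraph V) (C B : Finset V) (v : V) : Prop :=
  v ∉ C ∧ ∃ b ∈ B, Relation.ReflTransGen (fun x y => G.Adj x y ∧ y ∉ C) v b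

variable {G : Digraph V} {A B C W Y Z : Finset V}

theorem IsDAG.not_adj_of_adj (hG : IsDAG G) {u v : V} (h : G.Adj u v) : ¬ G.Adj v u := fun h' =>
  hG u (.tail (.single h) h')

theorem BlockedAt.symm {u v t : V} (h : BlockedAt G C u v t) : BlockedAt G C t v u := by
  unfold BlockedAt at *
  rwa [and_comm (a := G.Adj t v)]

theorem not_blockedAt_of_not_adj {u v t : V} (h : ¬ G.Adj u v) (hv : v ∉ C) :
    ¬ BlockedAt G C u v t := by
  rintro (h' | h')
  · exact hv h'.2
  · exact h h'.1.1

theorem not_blockedAt_of_collider {u v t d : V} (hu : G.Adj u v) (ht : G.Adj t v)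
    (hd : Relation.ReflTransGen G.Adj v d) (hC : d ∈ C) : ¬ BlockedAt G C u v t := by
  rintro (h' | h')
  · exact h'.1 ⟨hu, ht⟩
  · exact h'.2 d hd hC

theorem exists_mem_of_not_blockedAt {u v t : V} (h : ¬ BlockedAt G C u v t) (hu : G.Adj u v)
    (ht : G.Adj t v) : ∃ d ∈ C, Relation.ReflTransGen G.Adj v d := by
  by_contra! hc
  exact h (.inr ⟨⟨hu, ht⟩, fun d hd hC => hc d hC hd⟩)

theorem notMem_of_not_blockedAt {u v t : V} (h : ¬ BlockedAt G C u v t)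
    (h' : ¬ (G.Adj u v ∧ G.Adj t v)) : v ∉ C := fun hv => h (.inl ⟨h', hv⟩)

/-! ### Operations on treks and removal of loops. -/

namespace IsTrek

theorem tail_of_append {l r : List V} {v t : V} (h : IsTrek G A C (l ++ v :: t :: r)) :
    IsTrek G A C (v :: t :: r) := by
  induction l with
  | nil => exact h
  | cons x l ih =>
    apply ih
    rw [List.cons_append] at h
    generalize hm : l ++ v :: t :: r = m at h
    cases h with
    | base => rcases l with _ | ⟨_, _ | _⟩ <;> simp at hm
    | step _ _ _ hl => exact hm ▸ hl

theorem exists_concat {l : List V} (h : IsTrek G A C l) :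
    ∃ m a, l = m ++ [a] ∧ a ∈ A ∧ ∀ x ∈ m, x ∉ A := by
  induction h with
  | @base u a hu ha h => exact ⟨[u], a, rfl, ha, by simpa⟩
  | @step u v t l hu h hb hl ih =>
    obtain ⟨m, a, e, ha, hm⟩ := ih
    exact ⟨u :: m, a, by simp [e], ha, by simpa [hu] using hm⟩

theorem isChain {l : List V} (h : IsTrek G A C l) :
    l.IsChain fun u v => G.Adj u v ∨ G.Adj v u := by
  induction h with
  | base hu ha h => simp [h]
  | step hu h hb hl ih => exact List.isChain_cons_cons.2 ⟨h, ih⟩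

theorem not_blockedAt {l : List V} (h : IsTrek G A C l) {u v t : V} (hi : [u, v, t] <:+: l) :
    ¬ BlockedAt G C u v t := by
  induction h with
  | base hu ha h => exact absurd hi.length_le (by simp)
  | step hu h hb hl ih =>
    rcases List.infix_cons_iff.1 hi with hi | hi
    · simp only [List.cons_prefix_cons] at hi
      obtain ⟨rfl, rfl, rfl, -⟩ := hi
      exact hb
    · exact ih hi

theorem exists_arrow {l : List V} (h : IsTrek G A C l) :
    ∃ m u a, l = m ++ [u, a] ∧ G.Adj u a := by
  induction h with
  | @base u a hu ha h => exact ⟨[], u, a, rfl, h⟩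
  | @step u v t l hu h hb hl ih =>
    obtain ⟨m, u', a, e, h'⟩ := ih
    exact ⟨u :: m, u', a, by simp [e], h'⟩

theorem replace_tail {m r r' : List V} {s v : V} (h : IsTrek G A C (m ++ s :: v :: r))
    (h' : IsTrek G A C (s :: v :: r')) : IsTrek G A C (m ++ s :: v :: r') := by
  induction m with
  | nil => exact h'
  | cons x m ih =>
    rcases m with _ | ⟨y, _ | ⟨z, m⟩⟩
    · cases h with
      | step hu h hb hl => exact .step hu h hb h'
    · cases h with
      | step hu h hb hl => exact .step hu h hb (ih hl)
    · cases h with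
      | step hu h hb hl => exact .step hu h hb (ih hl)

/-- A loop that leaves `x` by an outgoing arrow either has an active collider, or its last arrow
points forward. -/
theorem exists_mem_or_arrow {b c : List V} {x n v t : V}
    (h : IsTrek G A C (x :: n :: (b ++ v :: t :: c))) (hx : G.Adj x n) :
    (∃ d ∈ C, Relation.ReflTransGen G.Adj x d) ∨ ∃ q, G.Adj q v ∧ ¬ BlockedAt G C q v t := by
  induction b generalizing x n with
  | nil =>
    cases h with
    | step hu h hb hl =>
      cases hl with
      | step hu' h' hb' hl' =>
        rcases h' with h' | h'
        · exact .inr ⟨n, h', hb'⟩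
        · obtain ⟨d, hd, hnd⟩ := exists_mem_of_not_blockedAt hb hx h'
          exact .inl ⟨d, hd, .head hx hnd⟩
  | cons y b ih =>
    cases h with
    | step hu h hb hl =>
      have hl2 := hl.isChain
      rcases (List.isChain_cons_cons.1 hl2).1 with h' | h'
      · rcases ih hl h' with ⟨d, hd, hnd⟩ | h
        · exact .inl ⟨d, hd, .head hx hnd⟩
        · exact .inr h
      · obtain ⟨d, hd, hnd⟩ := exists_mem_of_not_blockedAt hb hx h'
        exact .inl ⟨d, hd, .head hx hnd⟩

/-- Only the junction at `v` changes. If the new junction is a non-collider, one of the two old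
visits to `v` was one too, so `v ∉ C`. If it is a collider, the deleted loop provides a descendant
of `v` in `C`. -/
theorem remove_loop (hG : IsDAG G) {a b c : List V} {v : V}
    (h : IsTrek G A C (a ++ v :: (b ++ v :: c))) : IsTrek G A C (a ++ v :: c) := by
  rcases c with _ | ⟨t, c⟩
  -- If the second visit were the end of the trek, `v` would lie in `A`, but only the last node
  -- does.
  · obtain ⟨m, x, e, hx, hm⟩ := h.exists_concat
    have e' : (a ++ v :: b) ++ [v] = m ++ [x] := by simpa using e
    obtain ⟨rfl, rfl⟩ : a ++ v :: b = m ∧ v = x := by simpa using List.append_inj' e' rfl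
    exact absurd hx (hm v (by simp))
  have hv : IsTrek G A C (v :: t :: c) :=
    tail_of_append (l := a ++ v :: b) (by simpa using h)
  rcases List.eq_nil_or_concat a with rfl | ⟨a, s, rfl⟩
  · exact hv
  rw [List.concat_eq_append, List.append_assoc] at h ⊢
  refine h.replace_tail ?_
  rcases b with _ | ⟨n, b⟩
  · have := (tail_of_append (l := a ++ [s]) (by simpa using h) :
      IsTrek G A C (v :: v :: t :: c)).isChain
    have := (List.isChain_cons_cons.1 this).1
    rw [or_self] at this
    exact absurd (.single this) (hG v)
  have hs : IsTrek G A C (s :: v :: n :: (b ++ v :: t :: c)) :=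
    tail_of_append (l := a) (by simpa using h)
  cases hs with
  | step hu hsv hb hl =>
    refine .step hu hsv ?_ hv
    have hq : ∃ q, ¬ BlockedAt G C q v t := by
      rcases List.eq_nil_or_concat (n :: b) with h0 | ⟨b', q, hq⟩
      · simp at h0
      · refine ⟨q, hl.not_blockedAt ⟨v :: b', c, ?_⟩⟩
        simp only [← List.cons_append, hq]
        simp
    by_cases h1 : G.Adj s v
    · by_cases h2 : G.Adj t v
      · suffices ∃ d ∈ C, Relation.ReflTransGen G.Adj v d by
          obtain ⟨d, hd, hvd⟩ := this
          exact not_blockedAt_of_collider h1 h2 hvd hd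
        -- If the loop leaves `v` along an arrow, either its first reversal is an active collider
        -- below `v`, or it returns to `v` by an arrow and the second visit is an active collider.
        -- If the loop starts with an arrow into `v`, the first visit is one.
        rcases (List.isChain_cons_cons.1 hl.isChain).1 with h3 | h3
        · rcases hl.exists_mem_or_arrow h3 with h4 | ⟨q, h4, h5⟩
          · exact h4
          · exact exists_mem_of_not_blockedAt h5 h4 h2
        · exact exists_mem_of_not_blockedAt hb h1 h3
      · obtain ⟨q, hq⟩ := hq
        exact fun h' => not_blockedAt_of_not_adj h2
          (notMem_of_not_blockedAt hq fun h => h2 h.2) h'.symm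
    · exact not_blockedAt_of_not_adj h1 (notMem_of_not_blockedAt hb fun h => h1 h.1)

theorem exists_nodup (hG : IsDAG G) {y : V} {l : List V} (h : IsTrek G A C (y :: l)) :
    ∃ l', IsTrek G A C (y :: l') ∧ (y :: l').Nodup := by
  induction hn : l.length using Nat.strong_induction_on generalizing l with
  | _ n ih =>
    by_cases hd : (y :: l).Nodup
    · exact ⟨l, h, hd⟩
    have key : ∀ l : List V, ¬ l.Nodup → ∃ a v b c, l = a ++ v :: (b ++ v :: c) := by
      intro l
      induction l with
      | nil => simp
      | cons x l ih =>
        intro hl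
        by_cases hx : x ∈ l
        · obtain ⟨b, c, rfl⟩ := List.append_of_mem hx
          exact ⟨[], x, b, c, rfl⟩
        · obtain ⟨a, v, b, c, rfl⟩ := ih fun h => hl (List.nodup_cons.2 ⟨hx, h⟩)
          exact ⟨x :: a, v, b, c, rfl⟩
    obtain ⟨a, v, b, c, e⟩ := key _ hd
    rw [e] at h
    have h' := h.remove_loop hG
    have hlen := congrArg List.length e
    rcases a with _ | ⟨x, a⟩
    · obtain ⟨rfl, rfl⟩ : y = v ∧ l = b ++ v :: c := by simpa using e
      exact ih c.length (by simp at hlen; simp at hn; omega) h' rfl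
    · obtain ⟨rfl, rfl⟩ : y = x ∧ l = a ++ v :: (b ++ v :: c) := by simpa using e
      exact ih (a ++ v :: c).length (by simp at hn ⊢; omega) h' rfl

/-- An active trek gives an active path with distinct nodes. -/
theorem exists_backdoorPath (hG : IsDAG G) {y : V} {l : List V} (h : IsTrek G A C (y :: l)) :
    ∃ a ∈ A, ∃ r, IsBackdoorPath G a y r ∧ ¬ Blocks G C r := by
  obtain ⟨l', h', hd⟩ := h.exists_nodup hG
  obtain ⟨m, u, a, e, hua⟩ := h'.exists_arrow
  obtain ⟨m', a', e', ha, -⟩ := h'.exists_concat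
  obtain rfl : a = a' := by
    have := congrArg List.getLast? (e.symm.trans e')
    simpa using this
  -- Treks end in `A`, whereas back-door paths start there.
  refine ⟨a, ha, (y :: l').reverse, ⟨⟨?_, ?_, ?_, ?_⟩, u, m.reverse, ?_, hua⟩, ?_⟩
  · exact List.nodup_reverse.2 hd
  · rw [List.isChain_reverse]
    exact h'.isChain.imp fun _ _ => Or.symm
  · rw [e]; simp
  · simp
  · rw [e]; simp
  · rintro ⟨u, v, t, hi, hb⟩
    rw [← List.reverse_infix, List.reverse_reverse] at hi
    exact h'.not_blockedAt (u := t) (t := u) (by simpa using hi) (BlockedAt.symm hb)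

end IsTrek

/-! ### Directed paths and their conversion to treks. -/

namespace HasDirectedPathAvoiding

theorem of_adj {u v : V} (h : HasDirectedPathAvoiding G C B v) (huv : G.Adj u v) (hu : u ∉ C) :
    HasDirectedPathAvoiding G C B u := by
  obtain ⟨hv, b, hb, h⟩ := h
  exact ⟨hu, b, hb, .head ⟨huv, hv⟩ h⟩

theorem of_mem {v : V} (h : v ∈ B) (hC : v ∉ C) : HasDirectedPathAvoiding G C B v :=
  ⟨hC, v, h, .refl⟩

/-- Induction along the directed path, starting from its end. -/
@[elab_as_elim]
theorem induction {P : V → Prop} {v : V} (h : HasDirectedPathAvoiding G C B v)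
    (base : ∀ b ∈ B, b ∉ C → P b)
    (step : ∀ u w, u ∉ C → G.Adj u w → HasDirectedPathAvoiding G C B w → P w → P u) : P v := by
  obtain ⟨hv, b, hb, h⟩ := h
  induction h using Relation.ReflTransGen.head_induction_on with
  | refl => exact base b hb hv
  | head h1 h2 ih => exact step _ _ hv h1.1 ⟨h1.2, b, hb, h2⟩ (ih h1.2)

/-- Each node of the path inherits the property from the rest of the path, so the hypothesis applies
to all of them. -/
theorem mono {C' : Finset V} {v : V} (h : HasDirectedPathAvoiding G C B v)
    (hC : ∀ u, HasDirectedPathAvoiding G C B u → u ∉ C') :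
    HasDirectedPathAvoiding G C' B v :=
  h.induction (fun b hb hb' => of_mem hb (hC b (of_mem hb hb')))
    fun _ _ hu huw hw ih => ih.of_adj huw (hC _ (hw.of_adj huw hu))

theorem exists_isDirectedPath {v : V} (h : HasDirectedPathAvoiding G C B v) :
    ∃ b ∈ B, ∃ l, IsDirectedPath G v b l ∧ ∀ x ∈ l, x ∉ C := by
  refine h.induction (fun b hb hC => ⟨b, hb, [b], by simp [IsDirectedPath], by simpa⟩) ?_
  rintro u w hu huw - ⟨b, hb, l, ⟨h1, h2, h3⟩, h4⟩
  rcases l with _ | ⟨x, l⟩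
  · simp at h2
  obtain rfl : x = w := by simpa using h2
  refine ⟨b, hb, u :: x :: l, ⟨List.isChain_cons_cons.2 ⟨huw, h1⟩, rfl, ?_⟩, ?_⟩
  · rw [List.getLast?_cons_cons]; exact h3
  · simpa [hu] using h4

/-- A directed path into `A` is a trek. -/
theorem exists_isTrek (hG : IsDAG G) {v : V} (h : HasDirectedPathAvoiding G C A v) (hv : v ∉ A) :
    ∃ t l, G.Adj v t ∧ IsTrek G A C (v :: t :: l) := by
  revert hv
  refine h.induction (fun b hb _ hb' => absurd hb hb') ?_
  intro u w hu huw hw ih huA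
  by_cases hwA : w ∈ A
  · exact ⟨w, [], huw, .base huA hwA huw⟩
  · obtain ⟨t, l, hwt, hl⟩ := ih hwA
    exact ⟨w, t :: l, huw, .step huA (.inl huw)
      (fun hb => not_blockedAt_of_not_adj (hG.not_adj_of_adj hwt) hw.1 hb.symm) hl⟩

/-- A trek can be extended along a directed path avoiding the conditioning set. -/
theorem extend_isTrek [DecidableEq V] (hG : IsDAG G) {v : V} (t : V) (l : List V)
    (h : HasDirectedPathAvoiding G (A ∪ C) B v) (hl : IsTrek G A C (v :: t :: l)) :
    ∃ b ∈ B, ∃ r, IsTrek G A C (b :: r) := by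
  revert t l
  refine h.induction (fun b hb _ t l hl => ⟨b, hb, t :: l, hl⟩) ?_
  intro u w hu huw hw ih t l hl
  have h1 := hw.1
  simp only [Finset.mem_union, not_or] at hu h1
  exact ih _ _ (.step h1.1 (.inr huw) (not_blockedAt_of_not_adj (hG.not_adj_of_adj huw) hu.2) hl)

end HasDirectedPathAvoiding

theorem FrontDoor.notMem_of_hasDirectedPathAvoiding (h : FrontDoor G W Y Z) {v : V}
    (hv : HasDirectedPathAvoiding G Z Y v) : v ∉ W := fun hw => by
  obtain ⟨y, hy, l, hl, hlZ⟩ := hv.exists_isDirectedPath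
  obtain ⟨z, hz, hzl⟩ := h.intercepts v hw y hy l hl
  exact hlZ z hzl hz

variable [DecidableEq V]

/-- No node has both a directed path to `A` avoiding `C` and one to `B` avoiding `A ∪ C`. -/
theorem not_hasDirectedPathAvoiding_of_blocks (hG : IsDAG G)
    (hb : ∀ a ∈ A, ∀ y ∈ B, ∀ l, IsBackdoorPath G a y l → Blocks G C l) {v : V}
    (h1 : HasDirectedPathAvoiding G C A v) (h2 : HasDirectedPathAvoiding G (A ∪ C) B v) :
    False := by
  -- The two directed paths form a fork at `v`: a trek without colliders whose non-colliders avoid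
  -- `C`.
  obtain ⟨t, l, -, hl⟩ := h1.exists_isTrek hG fun hv => h2.1 (Finset.mem_union_left _ hv)
  obtain ⟨b, hbB, r, hr⟩ := h2.extend_isTrek hG t l hl
  obtain ⟨a, ha, r, h3, h4⟩ := hr.exists_backdoorPath hG
  exact h4 (hb a ha b hbB r h3)

/-- If all paths between `A` and `B` with an arrow into `A` are blocked by `C`, there is a set `S`
outside `A ∪ B ∪ C` that separates the families of the nodes of the ancestral graph of
`A ∪ B ∪ C`. -/
theorem exists_separating_set [Fintype V] (hG : IsDAG G)
    (hb : ∀ a ∈ A, ∀ y ∈ B, ∀ l, IsBackdoorPath G a y l → Blocks G C l) :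
    ∃ S : Finset V, (∀ v ∈ S, HasDirectedPathAvoiding G ∅ (C ∪ B ∪ A) v) ∧
      (∀ v ∈ S, v ∉ A ∧ v ∉ C) ∧ (∀ v ∈ S, v ∉ B) ∧
      (∀ k ∈ A, ∀ u, G.Adj u k → u ∈ S ∪ A ∪ C) ∧
      (∀ k, HasDirectedPathAvoiding G ∅ (C ∪ B ∪ A) k → (k ∈ S ∨ ∃ v ∈ S, G.Adj v k) →
        k ∈ S ∪ A ∪ C ∧ ∀ u, G.Adj u k → u ∈ S ∪ A ∪ C) := by
  classical
  have hno : ∀ y ∈ B, ∀ l, ¬ IsTrek G A C (y :: l) := fun y hy l hl => by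
    obtain ⟨a, ha, r, h3, h4⟩ := hl.exists_backdoorPath hG
    exact h4 (hb a ha y hy r h3)
  -- A parent `u` of the start `v` also starts a trek. The hard case is a collider at `v` with no
  -- descendant in `C`: being ancestral, `v` then reaches `A`, and that directed path is a new trek
  -- from `u`, or it reaches `B`, and the old trek extends to one from `B`, which is excluded.
  have ext : ∀ v t l, IsTrek G A C (v :: t :: l) → v ∉ C → v ∉ A →
      HasDirectedPathAvoiding G ∅ (C ∪ B ∪ A) v → ∀ u, G.Adj u v → u ∉ C → u ∉ A →
      ∃ r, IsTrek G A C (u :: r) := by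
    intro v t l hl hvC hvA hv u huv huC huA
    by_cases hvt : G.Adj v t
    · exact ⟨_, .step huA (.inl huv)
        (fun h => not_blockedAt_of_not_adj (hG.not_adj_of_adj hvt) hvC h.symm) hl⟩
    have htv : G.Adj t v := (List.isChain_cons_cons.1 hl.isChain).1.resolve_left hvt
    by_cases hd : ∃ d ∈ C, Relation.ReflTransGen G.Adj v d
    · obtain ⟨d, hd, hvd⟩ := hd
      exact ⟨_, .step huA (.inl huv) (not_blockedAt_of_collider huv htv hvd hd) hl⟩
    have hvC' : HasDirectedPathAvoiding G C (B ∪ A) v := by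
      revert hd
      refine hv.induction ?_ ?_
      · intro b hb _ hd
        have hbC : b ∉ C := fun h => hd ⟨b, h, .refl⟩
        simp only [Finset.mem_union] at hb
        exact .of_mem (by simp only [Finset.mem_union]; tauto) hbC
      · intro u w _ huw _ ih hd
        refine (ih ?_).of_adj huw fun h => hd ⟨u, h, .refl⟩
        rintro ⟨d, hdC, hwd⟩
        exact hd ⟨d, hdC, .head huw hwd⟩
    have hdich : HasDirectedPathAvoiding G C A v ∨ HasDirectedPathAvoiding G (A ∪ C) B v := by
      refine hvC'.induction ?_ ?_
      · intro b hb hbC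
        by_cases hbA : b ∈ A
        · exact .inl (.of_mem hbA hbC)
        · exact .inr (.of_mem ((Finset.mem_union.1 hb).resolve_right hbA) (by simp [hbA, hbC]))
      · rintro u w hu huw - (h | h)
        · exact .inl (h.of_adj huw hu)
        · by_cases huA : u ∈ A
          · exact .inl (.of_mem huA hu)
          · exact .inr (h.of_adj huw (by simp [huA, hu]))
    rcases hdich with h | h
    · exact ⟨_, (h.of_adj huv huC).exists_isTrek hG huA |>.choose_spec.choose_spec.2⟩
    · obtain ⟨b, hb, r, hr⟩ := h.extend_isTrek hG t l hl
      exact absurd hr (hno b hb r)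
  -- The separating set consists of the ancestral nodes outside `A ∪ C` that start a trek into `A`.
  let S : Finset V := Finset.univ.filter fun v =>
    HasDirectedPathAvoiding G ∅ (C ∪ B ∪ A) v ∧ v ∉ A ∧ v ∉ C ∧ ∃ t l, IsTrek G A C (v :: t :: l)
  have memS : ∀ v, v ∈ S ↔ HasDirectedPathAvoiding G ∅ (C ∪ B ∪ A) v ∧ v ∉ A ∧ v ∉ C ∧
    ∃ t l, IsTrek G A C (v :: t :: l) := by simp [S]
  have memS' : ∀ v, HasDirectedPathAvoiding G ∅ (C ∪ B ∪ A) v →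
      (v ∉ C → v ∉ A → ∃ r, IsTrek G A C (v :: r)) → v ∈ S ∪ A ∪ C := by
    intro v hv h
    by_cases hA : v ∈ A
    · simp [hA]
    by_cases hC : v ∈ C
    · simp [hC]
    obtain ⟨r, hr⟩ := h hC hA
    have : v ∈ S := by
      rcases r with _ | ⟨t, l⟩
      · cases hr
      · exact (memS v).2 ⟨hv, hA, hC, t, l, hr⟩
    simp [this]
  have parS : ∀ v ∈ S, ∀ u, G.Adj u v → u ∈ S ∪ A ∪ C := by
    intro v hv u huv
    obtain ⟨h1, h2, h3, t, l, hl⟩ := (memS v).1 hv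
    exact memS' u (h1.of_adj huv (by simp)) fun hC hA => ext v t l hl h3 h2 h1 u huv hC hA
  have parA : ∀ k ∈ A, ∀ u, G.Adj u k → u ∈ S ∪ A ∪ C := fun k hk u huk =>
    memS' u (HasDirectedPathAvoiding.of_adj (.of_mem (by simp [hk]) (by simp)) huk (by simp))
      fun hC hA => ⟨_, .base hA hk huk⟩
  refine ⟨S, fun v hv => ((memS v).1 hv).1, fun v hv => ⟨((memS v).1 hv).2.1, ((memS v).1 hv).2.2.1⟩,
    fun v hv hB => ?_, parA, ?_⟩
  · obtain ⟨t, l, h⟩ := ((memS v).1 hv).2.2.2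
    exact hno v hB _ h
  intro k hk hkS
  by_cases hkA : k ∈ A
  · exact ⟨by simp [hkA], parA k hkA⟩
  by_cases hkC : k ∈ C
  · refine ⟨by simp [hkC], fun u huk => ?_⟩
    -- A node `k ∈ C` with a parent in `S` is an active collider, so its other parents start treks
    -- as well.
    obtain ⟨v, hv, hvk⟩ := hkS.resolve_left fun h => ((memS k).1 h).2.2.1 hkC
    obtain ⟨h1, h2, h3, t, l, hl⟩ := (memS v).1 hv
    refine memS' u (hk.of_adj huk (by simp)) fun hC hA => ⟨_, .step hA (.inl huk)
      (not_blockedAt_of_collider huk hvk .refl hkC) (.step hkA (.inr hvk)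
        (not_blockedAt_of_not_adj (hG.not_adj_of_adj hvk) h3) hl)⟩
  have hkS' : k ∈ S := by
    rcases hkS with h | ⟨v, hv, hvk⟩
    · exact h
    obtain ⟨h1, h2, h3, t, l, hl⟩ := (memS v).1 hv
    exact (memS k).2 ⟨hk, hkA, hkC, v, t :: l, .step hkA (.inr hvk)
      (not_blockedAt_of_not_adj (hG.not_adj_of_adj hvk) h3) hl⟩
  exact ⟨by simp [hkS'], parS k hkS'⟩

end Treks

/-! ### Marginals of functions of finitely many variables -/

section Marginals

open Function

variable {V : Type*} [DecidableEq V] {ν : V → Measure ℂ}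

theorem dependsOn_lmarginal {g : (V → ℂ) → ℝ≥0∞} {s : Set V} (hg : DependsOn g s) (A : Finset V) :
    DependsOn (lmarginal ν A g) (s \ A) := by
  intro x y h
  refine lintegral_congr fun z => hg fun i hi => ?_
  by_cases hA : i ∈ A
  · simp [updateFinset_def, hA]
  · simpa [updateFinset_def, hA] using h i ⟨hi, hA⟩

theorem apply_updateFinset_of_dependsOn {β : Type*} {g : (V → ℂ) → β} {A : Finset V}
    (hg : DependsOn g (A : Set V)ᶜ) (x : V → ℂ) (y : A → ℂ) : g (updateFinset x A y) = g x :=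
  hg fun i hi => by
    have : i ∉ A := hi
    simp [updateFinset_def, this]

theorem lmarginal_updateFinset (g : (V → ℂ) → ℝ≥0∞) {A B : Finset V} (h : A ⊆ B) (x : V → ℂ)
    (y : A → ℂ) : lmarginal ν B g (updateFinset x A y) = lmarginal ν B g x :=
  apply_updateFinset_of_dependsOn ((dependsOn_lmarginal (dependsOn_univ g) B).mono fun _ hi hA =>
    hi.2 (h hA)) x y

theorem lmarginal_eq_zero_iff {g : (V → ℂ) → ℝ≥0∞} (hg : Measurable g) {A : Finset V} {x : V → ℂ} :
    lmarginal ν A g x = 0 ↔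
      ∀ᵐ y ∂(Measure.pi fun i : A => ν i), g (updateFinset x A y) = 0 :=
  lintegral_eq_zero_iff (hg.comp measurable_updateFinset)

theorem lmarginal_mul_left {g h : (V → ℂ) → ℝ≥0∞} {A : Finset V}
    (hg : DependsOn g (A : Set V)ᶜ) (hh : Measurable h) :
    lmarginal ν A (fun x => g x * h x) = fun x => g x * lmarginal ν A h x := by
  ext x
  simp only [lmarginal, apply_updateFinset_of_dependsOn hg]
  exact lintegral_const_mul (f := h ∘ updateFinset x A) _ (hh.comp measurable_updateFinset)

variable [∀ i, SigmaFinite (ν i)]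

theorem lmarginal_mul {g h : (V → ℂ) → ℝ≥0∞} {A B : Finset V} (hAB : Disjoint A B)
    (hg : DependsOn g (B : Set V)ᶜ) (hh : DependsOn h (A : Set V)ᶜ)
    (hgm : Measurable g) (hhm : Measurable h) :
    lmarginal ν (A ∪ B) (fun x => g x * h x) =
      fun x => lmarginal ν A g x * lmarginal ν B h x := by
  rw [lmarginal_union ν (fun x => g x * h x) (hgm.mul hhm) hAB, lmarginal_mul_left hg hhm]
  simp_rw [mul_comm (g _)]
  rw [lmarginal_mul_left ((dependsOn_lmarginal hh B).mono fun _ hi => hi.1) hgm]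
  simp_rw [mul_comm]

variable [Fintype V]

/-- Tonelli: the indicator of the exceptional set has vanishing `A`-marginal, hence vanishing
integral. -/
theorem ae_of_forall_ae_fiber {P : (V → ℂ) → Prop} (hP : MeasurableSet {x | P x}) (A : Finset V)
    (h : ∀ x, ∀ᵐ y ∂(Measure.pi fun i : A => ν i), P (updateFinset x A y)) :
    ∀ᵐ x ∂(Measure.pi ν), P x := by
  have hm : Measurable ({x | P x}ᶜ.indicator (fun _ => (1 : ℝ≥0∞))) :=
    measurable_const.indicator hP.compl
  have h0 : ∫⁻ x, {x | P x}ᶜ.indicator (fun _ => (1 : ℝ≥0∞)) x ∂(Measure.pi ν) =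
      ∫⁻ _, 0 ∂(Measure.pi ν) := by
    refine lintegral_eq_of_lmarginal_eq A hm measurable_const ?_
    ext x
    refine lintegral_congr_ae ?_
    filter_upwards [h x] with y hy
    simpa using hy
  rw [lintegral_zero, lintegral_indicator_const hP.compl, one_mul] at h0
  exact h0

theorem ae_ae_fiber {P : (V → ℂ) → Prop} (h : ∀ᵐ x ∂(Measure.pi ν), P x) (A : Finset V) :
    ∀ᵐ x ∂(Measure.pi ν), ∀ᵐ y ∂(Measure.pi fun i : A => ν i), P (updateFinset x A y) := by
  obtain ⟨N, hPN, hN, hN0⟩ := exists_measurable_superset_of_null (ae_iff.1 h)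
  have hm : Measurable (N.indicator (fun _ => (1 : ℝ≥0∞))) := measurable_const.indicator hN
  -- Integrating this marginal over the remaining coordinates gives the measure of `N`, which is
  -- zero.
  have key : ∀ᵐ x ∂(Measure.pi ν), lmarginal ν A (N.indicator fun _ => 1) x = 0 := by
    refine ae_of_forall_ae_fiber (hm.lmarginal ν (measurableSet_singleton 0)) Aᶜ fun x => ?_
    have : lmarginal ν Aᶜ (lmarginal ν A (N.indicator fun _ => 1)) x = 0 := by
      rw [← lmarginal_union ν _ hm disjoint_compl_left, Finset.union_comm,
        Finset.union_compl, ← lintegral_eq_lmarginal_univ, lintegral_indicator_const hN, hN0,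
        mul_zero]
    rwa [lmarginal_eq_zero_iff (hm.lmarginal ν)] at this
  filter_upwards [key] with x hx
  rw [lmarginal_eq_zero_iff hm] at hx
  filter_upwards [hx] with y hy
  by_contra hc
  have : updateFinset x A y ∈ N := hPN hc
  simp [this] at hy

theorem lmarginal_ae_congr {g h : (V → ℂ) → ℝ≥0∞} (hgh : g =ᵐ[Measure.pi ν] h) (A : Finset V) :
    lmarginal ν A g =ᵐ[Measure.pi ν] lmarginal ν A h := by
  filter_upwards [ae_ae_fiber hgh A] with x hx
  exact lintegral_congr_ae hx

theorem ae_eq_zero_of_lmarginal_eq_zero {g : (V → ℂ) → ℝ≥0∞} (hg : Measurable g) (A : Finset V) :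
    ∀ᵐ x ∂(Measure.pi ν), lmarginal ν A g x = 0 → g x = 0 := by
  refine ae_of_forall_ae_fiber ?_ A fun x => ?_
  · have h1 := hg.lmarginal (s := A) ν (measurableSet_singleton 0)
    have h2 := hg (measurableSet_singleton 0)
    convert h1.compl.union h2 using 1
    ext x
    simp [imp_iff_not_or]
  · simp only [lmarginal_updateFinset g subset_rfl]
    by_cases h : lmarginal ν A g x = 0
    · rw [lmarginal_eq_zero_iff hg] at h
      filter_upwards [h] with y hy _ using hy
    · simp [h]

theorem ae_ne_top_of_lmarginal_ne_top {g : (V → ℂ) → ℝ≥0∞} (hg : Measurable g) (A : Finset V)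
    (h : ∀ x, lmarginal ν A g x ≠ ∞) : ∀ᵐ x ∂(Measure.pi ν), g x ≠ ∞ :=
  ae_of_forall_ae_fiber (hg (measurableSet_singleton ∞)).compl A fun x =>
    (ae_lt_top (hg.comp measurable_updateFinset) (h x)).mono fun _ hy => hy.ne

end Marginals

/-! ### Products of Markov kernels over a directed acyclic graph -/

section KernelProducts

variable {V : Type*} [DecidableEq V]

/-- `p k` is a Markov kernel density of node `k` given its parents. -/
structure IsKernelFamily (ν : V → Measure ℂ) (G : Digraph V) (p : V → (V → ℂ) → ℝ≥0∞) :
    Prop where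
  measurable : ∀ k, Measurable (p k)
  dependsOn : ∀ k, DependsOn (p k) {j | j = k ∨ G.Adj j k}
  normalized : ∀ k x, lmarginal ν {k} (p k) x = 1

theorem Factorizes.isKernelFamily [Fintype V] {ν : V → Measure ℂ} {G : Digraph V} {f : (V → ℂ) → ℝ≥0∞}
    {p : V → (V → ℂ) → ℝ≥0∞} (h : Factorizes ν G f p) : IsKernelFamily ν G p where
  measurable k := (h.cond k).measurable
  dependsOn k := (h.cond k).dependsOn.mono fun j hj => by simpa [parents] using hj
  normalized k := (h.cond k).normalized

/-- The product of the kernels of the nodes in `S`. -/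
noncomputable def kernelProd (p : V → (V → ℂ) → ℝ≥0∞) (S : Finset V) (x : V → ℂ) : ℝ≥0∞ :=
  ∏ k ∈ S, p k x

namespace IsKernelFamily

variable {ν : V → Measure ℂ} {G : Digraph V} {p : V → (V → ℂ) → ℝ≥0∞}

theorem measurable_kernelProd (hp : IsKernelFamily ν G p) (S : Finset V) :
    Measurable (kernelProd p S) :=
  Finset.measurable_prod _ fun k _ => hp.measurable k

theorem dependsOn_kernelProd (hp : IsKernelFamily ν G p) {S : Finset V} {s : Set V}
    (h : ∀ k ∈ S, k ∈ s ∧ ∀ u, G.Adj u k → u ∈ s) : DependsOn (kernelProd p S) s :=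
  fun x y hxy => Finset.prod_congr rfl fun k hk => hp.dependsOn k fun i hi => hxy i (by
    rcases hi with rfl | hi
    · exact (h i hk).1
    · exact (h k hk).2 i hi)

theorem kernelProd_union {S R : Finset V} (h : Disjoint S R) :
    kernelProd p (S ∪ R) = fun x => kernelProd p S x * kernelProd p R x :=
  funext fun _ => Finset.prod_union h

variable [Fintype V] [∀ i, SigmaFinite (ν i)]

/-- Integrate `R` out in reverse topological order: a sink of `R` enters only its own factor, whose
integral is one. -/
theorem lmarginal_kernelProd_union (hp : IsKernelFamily ν G p) (hG : IsDAG G) {S R : Finset V}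
    (hSR : Disjoint S R) (h : ∀ s ∈ S, ∀ r ∈ R, ¬ G.Adj r s) :
    lmarginal ν R (kernelProd p (S ∪ R)) = kernelProd p S := by
  induction hn : R.card generalizing R with
  | zero =>
    obtain rfl := Finset.card_eq_zero.1 hn
    simp
  | succ n ih =>
    have : ∃ r ∈ R, ∀ r' ∈ R, ¬ G.Adj r r' := by
      have : Std.Irrefl (Function.swap (Relation.TransGen G.Adj)) := ⟨hG⟩
      have : IsTrans V (Function.swap (Relation.TransGen G.Adj)) :=
        ⟨fun a b c h1 h2 => Relation.TransGen.trans h2 h1⟩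
      have wf := Finite.wellFounded_of_trans_of_irrefl (Function.swap (Relation.TransGen G.Adj))
      obtain ⟨r, hr, hmin⟩ := wf.has_min (R : Set V)
        (Finset.coe_nonempty.2 (Finset.card_pos.1 (by omega)))
      exact ⟨r, hr, fun r' hr' h' => hmin r' hr' (.single h')⟩
    obtain ⟨r, hr, hsink⟩ := this
    have hrS : r ∉ S := fun hS => Finset.disjoint_left.1 hSR hS hr
    have hd : Disjoint S (R.erase r) := hSR.mono_right (Finset.erase_subset _ _)
    have hd' : Disjoint (S ∪ R.erase r) {r} := by simp [hrS]
    have e : S ∪ R = (S ∪ R.erase r) ∪ {r} := by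
      ext i
      by_cases hi : i = r <;> simp [hi, hr]
    have e' : lmarginal ν {r} (kernelProd p (S ∪ R)) = kernelProd p (S ∪ R.erase r) := by
      rw [e, kernelProd_union hd', lmarginal_mul_left _ (hp.measurable_kernelProd _)]
      · ext x
        have : kernelProd p {r} = p r := by ext x; simp [kernelProd]
        rw [this, hp.normalized, mul_one]
      · refine hp.dependsOn_kernelProd fun k hk => ⟨fun hkr => ?_, fun u huk hur => ?_⟩
        · obtain rfl : k = r := by simpa using hkr
          exact Finset.disjoint_left.1 hd' hk (by simp)
        · obtain rfl : u = r := by simpa using hur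
          rcases Finset.mem_union.1 hk with hk | hk
          · exact h k hk u hr huk
          · exact hsink k (Finset.mem_of_mem_erase hk) huk
    have eR : R = R.erase r ∪ {r} := by
      ext i
      by_cases hi : i = r <;> simp [hi, hr]
    nth_rw 1 [eR]
    rw [lmarginal_union ν _ (hp.measurable_kernelProd _) (by simp), e']
    exact ih hd (fun s hs r' hr' => h s hs r' (Finset.mem_of_mem_erase hr'))
      (by rw [Finset.card_erase_of_mem hr]; omega)

/-- Nodes outside an ancestral set integrate to one. -/
theorem lmarginal_sdiff (hp : IsKernelFamily ν G p) (hG : IsDAG G) {B S T : Finset V}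
    (hBS : B ⊆ S) (hST : S ⊆ T) (h : ∀ s ∈ S, ∀ r ∈ T, G.Adj r s → r ∈ S) :
    lmarginal ν (T \ B) (kernelProd p T) = lmarginal ν (S \ B) (kernelProd p S) := by
  have e : T \ B = S \ B ∪ T \ S := by
    ext i
    have h1 := @hBS i
    have h2 := @hST i
    simp only [Finset.mem_sdiff, Finset.mem_union]
    tauto
  rw [e, lmarginal_union ν _ (hp.measurable_kernelProd _)
    (Finset.disjoint_sdiff.mono_left Finset.sdiff_subset)]
  congr 1
  have := hp.lmarginal_kernelProd_union hG (S := S) (R := T \ S) Finset.disjoint_sdiff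
  rw [Finset.union_sdiff_of_subset hST] at this
  refine this fun s hs r hr hrs => ?_
  rw [Finset.mem_sdiff] at hr
  exact hr.2 (h s hs r hr.1 hrs)

end IsKernelFamily

end KernelProducts

/-! ### The front-door adjustment -/

section FrontDoorAdjustment

variable {V : Type*} [Fintype V]

open Classical in
/-- The nodes with a directed path to `B` all of whose nodes are outside `C`. -/
noncomputable def ancestorsAvoiding (G : Digraph V) (C B : Finset V) : Finset V :=
  Finset.univ.filter (HasDirectedPathAvoiding G C B)

variable {ν : V → Measure ℂ} {G : Digraph V} {p : V → (V → ℂ) → ℝ≥0∞} {A B C W Y Z : Finset V}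

theorem mem_ancestorsAvoiding {v : V} :
    v ∈ ancestorsAvoiding G C B ↔ HasDirectedPathAvoiding G C B v := by
  simp [ancestorsAvoiding]

theorem mem_ancestorsAvoiding_of_adj {u v : V} (h : v ∈ ancestorsAvoiding G C B)
    (huv : G.Adj u v) : u ∈ ancestorsAvoiding G C B ∨ u ∈ C := by
  by_cases hu : u ∈ C
  · exact .inr hu
  · exact .inl (mem_ancestorsAvoiding.2 ((mem_ancestorsAvoiding.1 h).of_adj huv hu))

theorem subset_ancestorsAvoiding (h : Disjoint B C) : B ⊆ ancestorsAvoiding G C B := fun _ hv =>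
  mem_ancestorsAvoiding.2 (.of_mem hv (Finset.disjoint_left.1 h hv))

theorem notMem_of_mem_ancestorsAvoiding {v : V} (h : v ∈ ancestorsAvoiding G C B) : v ∉ C :=
  (mem_ancestorsAvoiding.1 h).1

variable [DecidableEq V]

/-- A common node would be a fork joining `W` to `Z` with an arrow into `W` and no collider, against
condition 3. -/
theorem FrontDoor.disjoint_ancestors_treatment (h : FrontDoor G W Y Z) (hG : IsDAG G) :
    Disjoint (ancestorsAvoiding G ∅ W) (ancestorsAvoiding G W Z) :=
  Finset.disjoint_left.2 fun _ h1 h2 => not_hasDirectedPathAvoiding_of_blocks hG h.backdoor_WZ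
    (mem_ancestorsAvoiding.1 h1) (by simpa using mem_ancestorsAvoiding.1 h2)

/-- A common node would be a fork violating condition 2. Condition 1 is what makes its branch to `Y`
avoid `W` in addition to `Z`. -/
theorem FrontDoor.disjoint_ancestors_outcome (h : FrontDoor G W Y Z) (hG : IsDAG G) :
    Disjoint (ancestorsAvoiding G W Z) (ancestorsAvoiding G Z Y) :=
  Finset.disjoint_left.2 fun _ h1 h2 => not_hasDirectedPathAvoiding_of_blocks hG h.backdoor_ZY
    (mem_ancestorsAvoiding.1 h1) ((mem_ancestorsAvoiding.1 h2).mono fun u hu => by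
      simp [hu.1, h.notMem_of_hasDirectedPathAvoiding hu])

/-! ### Observational and interventional densities of kernel products. -/

namespace IsKernelFamily

variable [∀ i, SigmaFinite (ν i)]

theorem margDensity_eq (hp : IsKernelFamily ν G p) (hG : IsDAG G) {S : Finset V} (hBS : B ⊆ S)
    (h : ∀ s ∈ S, ∀ r, G.Adj r s → r ∈ S) :
    margDensity ν (kernelProd p Finset.univ) B = lmarginal ν (S \ B) (kernelProd p S) := by
  rw [margDensity, Finset.compl_eq_univ_sdiff]
  exact hp.lmarginal_sdiff hG hBS (Finset.subset_univ _) fun s hs r _ => h s hs r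

theorem doDensity_eq (hp : IsKernelFamily ν G p) (hG : IsDAG G) {S : Finset V} (hBS : B ⊆ S)
    (hS : Disjoint S C) (h : ∀ s ∈ S, ∀ r, G.Adj r s → r ∈ S ∨ r ∈ C) :
    doDensity ν p C B = lmarginal ν (S \ B) (kernelProd p S) := by
  have e : (C ∪ B)ᶜ = Cᶜ \ B := by ext; simp
  rw [doDensity, e]
  refine hp.lmarginal_sdiff hG hBS (fun i hi => ?_) fun s hs r hr hrs => ?_
  · simpa using Finset.disjoint_left.1 hS hi
  · exact (h s hs r hrs).resolve_right (by simpa using hr)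

theorem measurable_margDensity (hp : IsKernelFamily ν G p) (B : Finset V) :
    Measurable (margDensity ν (kernelProd p Finset.univ) B) :=
  (hp.measurable_kernelProd _).lmarginal ν

theorem measurable_doDensity (hp : IsKernelFamily ν G p) (C B : Finset V) :
    Measurable (doDensity ν p C B) :=
  (hp.measurable_kernelProd _).lmarginal ν

theorem lmarginal_margDensity (hp : IsKernelFamily ν G p) (h : Disjoint A B) :
    lmarginal ν A (margDensity ν (kernelProd p Finset.univ) (A ∪ B)) =
      margDensity ν (kernelProd p Finset.univ) B := by
  have e : Bᶜ = A ∪ (A ∪ B)ᶜ := by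
    ext i
    have h1 : i ∈ A → i ∉ B := fun hi => Finset.disjoint_left.1 h hi
    simp only [Finset.mem_compl, Finset.mem_union]
    tauto
  rw [margDensity, margDensity, e, lmarginal_union ν _ (hp.measurable_kernelProd _)]
  exact Finset.disjoint_left.2 fun i hi hi' => by simp [hi] at hi'

theorem lmarginal_doDensity (hp : IsKernelFamily ν G p) (h : Disjoint A B) (hC : Disjoint A C) :
    lmarginal ν A (doDensity ν p C (A ∪ B)) = doDensity ν p C B := by
  have e : (C ∪ B)ᶜ = A ∪ (C ∪ (A ∪ B))ᶜ := by
    ext i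
    have h1 : i ∈ A → i ∉ B := fun hi => Finset.disjoint_left.1 h hi
    have h2 : i ∈ A → i ∉ C := fun hi => Finset.disjoint_left.1 hC hi
    simp only [Finset.mem_compl, Finset.mem_union]
    tauto
  rw [doDensity, doDensity, e]
  refine (lmarginal_union ν _ (hp.measurable_kernelProd Cᶜ) ?_).symm
  exact Finset.disjoint_left.2 fun i hi hi' => by simp [hi] at hi'

/-- The total mass is one: the empty set is ancestral and its kernel product is the empty product.
-/
theorem margDensity_ne_top (hp : IsKernelFamily ν G p) (hG : IsDAG G) (B : Finset V) :
    ∀ᵐ x ∂(Measure.pi ν), margDensity ν (kernelProd p Finset.univ) B x ≠ ∞ := by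
  refine ae_ne_top_of_lmarginal_ne_top (hp.measurable_margDensity B) B fun x => ?_
  have h1 := hp.lmarginal_margDensity (A := B) (B := ∅) (Finset.disjoint_empty_right _)
  have h2 := hp.margDensity_eq hG (B := ∅) (S := ∅) subset_rfl (by simp)
  rw [Finset.union_empty] at h1
  rw [h1, h2]
  simp [kernelProd]

/-- There is no confounding between the treatment and the front-door nodes. -/
theorem margDensity_union_eq_mul (hp : IsKernelFamily ν G p) (hG : IsDAG G) (hWZ : Disjoint W Z)
    (h : FrontDoor G W Y Z) :
    margDensity ν (kernelProd p Finset.univ) (W ∪ Z) = fun x =>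
      margDensity ν (kernelProd p Finset.univ) W x * doDensity ν p W Z x := by
  set S := ancestorsAvoiding G ∅ W
  set T := ancestorsAvoiding G W Z
  have hST : Disjoint S T := h.disjoint_ancestors_treatment hG
  have hWS : W ⊆ S := subset_ancestorsAvoiding (Finset.disjoint_empty_right _)
  have hZT : Z ⊆ T := subset_ancestorsAvoiding hWZ.symm
  have hSpar : ∀ s ∈ S, ∀ r, G.Adj r s → r ∈ S := fun s hs r hr => by
    simpa using mem_ancestorsAvoiding_of_adj hs hr
  have hTpar : ∀ s ∈ T, ∀ r, G.Adj r s → r ∈ T ∨ r ∈ W := fun s hs r hr =>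
    mem_ancestorsAvoiding_of_adj hs hr
  have hTW : Disjoint T W := (hST.mono_left hWS).symm
  rw [hp.margDensity_eq hG hWS hSpar, hp.doDensity_eq hG hZT hTW hTpar,
    hp.margDensity_eq hG (Finset.union_subset_union hWS hZT), kernelProd_union hST]
  · have e : (S ∪ T) \ (W ∪ Z) = S \ W ∪ T \ Z := by
      ext i
      have h1 : i ∈ S → i ∉ T := fun hi => Finset.disjoint_left.1 hST hi
      have h2 := @hWS i
      have h3 := @hZT i
      simp only [Finset.mem_sdiff, Finset.mem_union]
      tauto
    rw [e]
    refine lmarginal_mul (hST.mono Finset.sdiff_subset Finset.sdiff_subset)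
      (hp.dependsOn_kernelProd fun k hk => ?_) (hp.dependsOn_kernelProd fun k hk => ?_)
      (hp.measurable_kernelProd _) (hp.measurable_kernelProd _)
    · have key : ∀ u ∈ S, u ∈ ((T \ Z : Finset V) : Set V)ᶜ := fun u hu hu' =>
        Finset.disjoint_left.1 hST hu (Finset.mem_sdiff.1 hu').1
      exact ⟨key k hk, fun u hu => key u (hSpar k hk u hu)⟩
    · have key : ∀ u, u ∈ T ∨ u ∈ W → u ∈ ((S \ W : Finset V) : Set V)ᶜ := by
        rintro u (hu | hu) hu'
        · exact Finset.disjoint_left.1 hST (Finset.mem_sdiff.1 hu').1 hu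
        · exact (Finset.mem_sdiff.1 hu').2 hu
      exact ⟨key k (.inl hk), fun u hu => key u (hTpar k hk u hu)⟩
  · intro s hs r hr
    rw [Finset.mem_union] at hs ⊢
    rcases hs with hs | hs
    · exact .inl (hSpar s hs r hr)
    · exact (hTpar s hs r hr).symm.imp (@hWS r) id

/-- The effect of the treatment is mediated by the front-door nodes. -/
theorem doDensity_eq_lmarginal_mul (hp : IsKernelFamily ν G p) (hG : IsDAG G)
    (hWZ : Disjoint W Z) (hZY : Disjoint Z Y) (h : FrontDoor G W Y Z) :
    doDensity ν p W Y = lmarginal ν Z fun x => doDensity ν p W Z x * doDensity ν p Z Y x := by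
  set S := ancestorsAvoiding G W Z
  set T := ancestorsAvoiding G Z Y
  have hST : Disjoint S T := h.disjoint_ancestors_outcome hG
  have hZS : Z ⊆ S := subset_ancestorsAvoiding hWZ.symm
  have hYT : Y ⊆ T := subset_ancestorsAvoiding hZY.symm
  have hSpar : ∀ s ∈ S, ∀ r, G.Adj r s → r ∈ S ∨ r ∈ W := fun s hs r hr =>
    mem_ancestorsAvoiding_of_adj hs hr
  have hTpar : ∀ s ∈ T, ∀ r, G.Adj r s → r ∈ T ∨ r ∈ Z := fun s hs r hr =>
    mem_ancestorsAvoiding_of_adj hs hr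
  have hSW : Disjoint S W := Finset.disjoint_left.2 fun v => notMem_of_mem_ancestorsAvoiding
  have hTZ : Disjoint T Z := Finset.disjoint_left.2 fun v => notMem_of_mem_ancestorsAvoiding
  have hTW : Disjoint T W := Finset.disjoint_left.2 fun v hv =>
    h.notMem_of_hasDirectedPathAvoiding (mem_ancestorsAvoiding.1 hv)
  rw [hp.doDensity_eq hG hZS hSW hSpar, hp.doDensity_eq hG hYT hTZ hTpar,
    hp.doDensity_eq hG (hYT.trans Finset.subset_union_right)
      (Finset.disjoint_union_left.2 ⟨hSW, hTW⟩), kernelProd_union hST]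
  · have e : (S ∪ T) \ Y = Z ∪ (S \ Z ∪ T \ Y) := by
      ext i
      have h1 : i ∈ S → i ∉ T := fun hi => Finset.disjoint_left.1 hST hi
      have h2 := @hZS i
      have h3 := @hYT i
      simp only [Finset.mem_sdiff, Finset.mem_union]
      tauto
    have hd : Disjoint Z (S \ Z ∪ T \ Y) := Finset.disjoint_union_right.2
      ⟨Finset.disjoint_sdiff, (hTZ.mono_left Finset.sdiff_subset).symm⟩
    rw [e, lmarginal_union ν (fun x => kernelProd p S x * kernelProd p T x)
      ((hp.measurable_kernelProd S).mul (hp.measurable_kernelProd T)) hd]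
    congr 1
    refine lmarginal_mul (hST.mono Finset.sdiff_subset Finset.sdiff_subset)
      (hp.dependsOn_kernelProd fun k hk => ?_) (hp.dependsOn_kernelProd fun k hk => ?_)
      (hp.measurable_kernelProd _) (hp.measurable_kernelProd _)
    · have key : ∀ u, u ∈ S ∨ u ∈ W → u ∈ ((T \ Y : Finset V) : Set V)ᶜ := by
        rintro u (hu | hu) hu'
        · exact Finset.disjoint_left.1 hST hu (Finset.mem_sdiff.1 hu').1
        · exact Finset.disjoint_left.1 hTW (Finset.mem_sdiff.1 hu').1 hu
      exact ⟨key k (.inl hk), fun u hu => key u (hSpar k hk u hu)⟩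
    · have key : ∀ u, u ∈ T ∨ u ∈ Z → u ∈ ((S \ Z : Finset V) : Set V)ᶜ := by
        rintro u (hu | hu) hu'
        · exact Finset.disjoint_left.1 hST (Finset.mem_sdiff.1 hu').1 hu
        · exact (Finset.mem_sdiff.1 hu').2 hu
      exact ⟨key k (.inl hk), fun u hu => key u (hTpar k hk u hu)⟩
  · intro s hs r hr
    rw [Finset.mem_union] at hs ⊢
    rcases hs with hs | hs
    · exact (hSpar s hs r hr).imp_left .inl
    · exact .inl ((hTpar s hs r hr).symm.imp (@hZS r) id)

/-- Intervening on the front-door nodes does not change the law of the treatment. -/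
theorem doDensity_treatment (hp : IsKernelFamily ν G p) (hG : IsDAG G) (hWZ : Disjoint W Z)
    (h : FrontDoor G W Y Z) :
    doDensity ν p Z W = margDensity ν (kernelProd p Finset.univ) W := by
  have hWS : W ⊆ ancestorsAvoiding G ∅ W :=
    subset_ancestorsAvoiding (Finset.disjoint_empty_right _)
  have hpar : ∀ s ∈ ancestorsAvoiding G ∅ W, ∀ r, G.Adj r s → r ∈ ancestorsAvoiding G ∅ W :=
    fun s hs r hr => by simpa using mem_ancestorsAvoiding_of_adj hs hr
  rw [hp.margDensity_eq hG hWS hpar, hp.doDensity_eq hG hWS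
    ((h.disjoint_ancestors_treatment hG).mono_right (subset_ancestorsAvoiding hWZ.symm))
    fun s hs r hr => .inl (hpar s hs r hr)]

/-- The treatment blocks the confounding between the front-door nodes and the outcome. -/
theorem doDensity_mul_margDensity (hp : IsKernelFamily ν G p) (hG : IsDAG G)
    (hWZ : Disjoint W Z) (hZY : Disjoint Z Y) (h : FrontDoor G W Y Z) (x : V → ℂ) :
    doDensity ν p Z (Y ∪ W) x * margDensity ν (kernelProd p Finset.univ) (W ∪ Z) x =
      margDensity ν (kernelProd p Finset.univ) (Y ∪ (W ∪ Z)) x *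
        margDensity ν (kernelProd p Finset.univ) W x := by
  classical
  obtain ⟨S, hSN, hSAC, hSB, hA, hK⟩ := exists_separating_set hG h.backdoor_ZY
  set N := ancestorsAvoiding G ∅ (W ∪ Y ∪ Z) with hN
  have hsub : W ∪ Y ∪ Z ⊆ N := subset_ancestorsAvoiding (Finset.disjoint_empty_right _)
  have hNpar : ∀ s ∈ N, ∀ r, G.Adj r s → r ∈ N := fun s hs r hr =>
    (mem_ancestorsAvoiding_of_adj hs hr).resolve_right (Finset.notMem_empty r)
  -- Factors in `K` involve only `S ∪ Z ∪ W`, those in `N \ K` never involve `S`, so integrals over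
  -- `S` and over parts of `R` separate. Intervening on `Z` changes only the `K` part, and
  -- marginalizing over `Y` only the other one; hence both sides of the claim are the same product
  -- of four integrals.
  let K := N.filter fun k => k ∈ Z ∨ k ∈ S ∨ ∃ v ∈ S, G.Adj v k
  let R := N \ (S ∪ Z ∪ W)
  have hKdep : ∀ k ∈ K, k ∈ S ∪ Z ∪ W ∧ ∀ u, G.Adj u k → u ∈ S ∪ Z ∪ W := by
    intro k hk
    obtain ⟨hkN, hk | hk⟩ := Finset.mem_filter.1 hk
    · exact ⟨by simp [hk], hA k hk⟩
    · exact hK k (mem_ancestorsAvoiding.1 hkN) hk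
  have hZK : Z ⊆ K := fun k hk => Finset.mem_filter.2 ⟨hsub (by simp [hk]), .inl hk⟩
  have hR : ∀ u ∈ R, u ∉ S ∪ Z ∪ W := fun u hu => (Finset.mem_sdiff.1 hu).2
  have hSR : Disjoint S R := Finset.disjoint_left.2 fun u hu hu' => hR u hu' (by simp [hu])
  have factor : ∀ K' ⊆ K, ∀ R' ⊆ R, lmarginal ν (S ∪ R') (kernelProd p (K' ∪ N \ K)) =
      fun x => lmarginal ν S (kernelProd p K') x * lmarginal ν R' (kernelProd p (N \ K)) x := by
    intro K' hK' R' hR'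
    rw [kernelProd_union (Finset.disjoint_sdiff.mono_left hK')]
    refine lmarginal_mul (hSR.mono_right hR')
      (hp.dependsOn_kernelProd fun k hk => ?_) (hp.dependsOn_kernelProd fun k hk => ?_)
      (hp.measurable_kernelProd _) (hp.measurable_kernelProd _)
    · have := hKdep k (hK' hk)
      exact ⟨fun hk' => hR k (hR' hk') this.1, fun u hu hu' => hR u (hR' hu') (this.2 u hu)⟩
    · obtain ⟨hkN, hk⟩ := Finset.mem_sdiff.1 hk
      exact ⟨fun hk' => hk (Finset.mem_filter.2 ⟨hkN, .inr (.inl hk')⟩),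
        fun u hu hu' => hk (Finset.mem_filter.2 ⟨hkN, .inr (.inr ⟨u, hu', hu⟩)⟩)⟩
  have e0 : K ∪ N \ K = N := Finset.union_sdiff_of_subset (Finset.filter_subset _ _)
  have e1 : K \ Z ∪ N \ K = N \ Z := by
    ext i
    have h1 : i ∈ K → i ∈ N := fun hi => Finset.filter_subset _ _ hi
    have h2 := @hZK i
    simp only [Finset.mem_sdiff, Finset.mem_union]
    tauto
  have hSN' : ∀ i ∈ S, i ∈ N := fun i hi => mem_ancestorsAvoiding.2 (hSN i hi)
  have e2 : N \ (W ∪ Z) = S ∪ R := by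
    ext i
    have h1 := hSN' i
    have h2 := hSAC i
    simp only [Finset.mem_sdiff, Finset.mem_union, R]
    tauto
  have e3 : N \ (Y ∪ (W ∪ Z)) = S ∪ R \ Y := by
    ext i
    have h1 := hSN' i
    have h2 := hSAC i
    have h3 := hSB i
    simp only [Finset.mem_sdiff, Finset.mem_union, R]
    tauto
  have e4 : (N \ Z) \ W = S ∪ R := by
    rw [← e2]; ext i; simp only [Finset.mem_sdiff, Finset.mem_union]; tauto
  have e5 : (N \ Z) \ (Y ∪ W) = S ∪ R \ Y := by
    rw [← e3]; ext i; simp only [Finset.mem_sdiff, Finset.mem_union]; tauto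
  have hdo : ∀ B ⊆ N \ Z, doDensity ν p Z B = lmarginal ν ((N \ Z) \ B) (kernelProd p (N \ Z)) :=
    fun B hB => hp.doDensity_eq hG hB Finset.sdiff_disjoint fun s hs r hr => by
      have := hNpar s (Finset.mem_sdiff.1 hs).1 r hr
      simp only [Finset.mem_sdiff]
      tauto
  have f1 := factor K subset_rfl R subset_rfl
  have f2 := factor K subset_rfl (R \ Y) Finset.sdiff_subset
  have f3 := factor (K \ Z) Finset.sdiff_subset R subset_rfl
  have f4 := factor (K \ Z) Finset.sdiff_subset (R \ Y) Finset.sdiff_subset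
  rw [e0] at f1 f2
  rw [e1] at f3 f4
  have hW : W ⊆ N \ Z := fun i hi => Finset.mem_sdiff.2
    ⟨hsub (by simp [hi]), Finset.disjoint_left.1 hWZ hi⟩
  have hY : Y ⊆ N \ Z := fun i hi => Finset.mem_sdiff.2
    ⟨hsub (by simp [hi]), Finset.disjoint_right.1 hZY hi⟩
  have hZN : Z ⊆ N := fun i hi => hsub (by simp [hi])
  rw [← hp.doDensity_treatment hG hWZ h, hdo W hW, hdo (Y ∪ W) (Finset.union_subset hY hW),
    hp.margDensity_eq hG (S := N) (Finset.union_subset (hW.trans Finset.sdiff_subset) hZN) hNpar,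
    hp.margDensity_eq hG (S := N) (Finset.union_subset (hY.trans Finset.sdiff_subset)
      (Finset.union_subset (hW.trans Finset.sdiff_subset) hZN)) hNpar,
    e2, e3, e4, e5, f1, f2, f3, f4]
  ring

/-- The front-door adjustment for a product of Markov kernels. -/
theorem doDensity_eq_frontDoorFormula (hp : IsKernelFamily ν G p) (hG : IsDAG G)
    (hWY : Disjoint W Y) (hWZ : Disjoint W Z) (hZY : Disjoint Z Y) (h : FrontDoor G W Y Z)
    (hpos : ∀ᵐ x ∂(Measure.pi ν), 0 < margDensity ν (kernelProd p Finset.univ) W x →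
      0 < margDensity ν (kernelProd p Finset.univ) Z x →
      0 < margDensity ν (kernelProd p Finset.univ) (W ∪ Z) x) :
    ∀ᵐ x ∂(Measure.pi ν), 0 < margDensity ν (kernelProd p Finset.univ) W x →
      doDensity ν p W Y x = frontDoorFormula ν (kernelProd p Finset.univ) W Y Z x := by
  set F := kernelProd p Finset.univ
  have hmulWZ := hp.margDensity_union_eq_mul hG hWZ h
  have hmargZ := hp.lmarginal_margDensity hWZ
  have hmargY : lmarginal ν Y (doDensity ν p Z (Y ∪ W)) = margDensity ν F W := by
    rw [hp.lmarginal_doDensity hWY.symm hZY.symm, hp.doDensity_treatment hG hWZ h]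
  have hmargW : lmarginal ν W (doDensity ν p Z (Y ∪ W)) = doDensity ν p Z Y := by
    rw [Finset.union_comm, hp.lmarginal_doDensity hWY hWZ]
  have hfin := hp.margDensity_ne_top hG W
  have hnull := ae_eq_zero_of_lmarginal_eq_zero (hp.measurable_doDensity Z (Y ∪ W)) Y (ν := ν)
  have hnullZ := ae_eq_zero_of_lmarginal_eq_zero (hp.measurable_margDensity (W ∪ Z)) W (ν := ν)
  rw [hmargY] at hnull
  rw [hmargZ] at hnullZ
  -- The back-door formula, at points where f(w,z) ≠ 0. There f(z) > 0, so positivity gives f(w',z)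
  -- > 0 for almost all w' with f(w') > 0, which allows division; where f(w') = 0, also f(y,w' | do
  -- z) = 0 almost everywhere.
  have inner : ∀ᵐ x ∂(Measure.pi ν), margDensity ν F (W ∪ Z) x ≠ 0 →
      lmarginal ν W (fun x' => condDensity ν F Y (W ∪ Z) x' * margDensity ν F W x') x =
        doDensity ν p Z Y x := by
    filter_upwards [hnullZ, ae_ae_fiber hpos W, ae_ae_fiber hnull W,
      ae_ae_fiber (hp.margDensity_ne_top hG (W ∪ Z)) W] with x h1 h2 h3 h4 hx
    rw [← hmargW]
    refine lintegral_congr_ae ?_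
    filter_upwards [h2, h3, h4] with y h2 h3 h4
    have hZx : margDensity ν F Z (Function.updateFinset x W y) = margDensity ν F Z x :=
      lmarginal_updateFinset F (fun i hi => by simpa using Finset.disjoint_left.1 hWZ hi) x y
    rw [hZx] at h2
    rcases eq_or_ne (margDensity ν F W (Function.updateFinset x W y)) 0 with h0 | h0
    · rw [h3 h0, h0, mul_zero]
    · have h5 := h2 (pos_iff_ne_zero.2 h0) (pos_iff_ne_zero.2 fun hc => hx (h1 hc))
      rw [condDensity, div_eq_mul_inv, mul_right_comm,
        ← hp.doDensity_mul_margDensity hG hWZ hZY h, mul_assoc,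
        ENNReal.mul_inv_cancel h5.ne' h4, mul_one]
  filter_upwards [hfin, ae_ae_fiber inner Z] with x h1 h2 h0
  rw [hp.doDensity_eq_lmarginal_mul hG hWZ hZY h, frontDoorFormula]
  refine lintegral_congr_ae ?_
  filter_upwards [h2] with y h2
  have hWx : margDensity ν F W (Function.updateFinset x Z y) = margDensity ν F W x :=
    lmarginal_updateFinset F (fun i hi => by simpa using Finset.disjoint_right.1 hWZ hi) x y
  have hcond : condDensity ν F Z W (Function.updateFinset x Z y) =
      doDensity ν p W Z (Function.updateFinset x Z y) := by
    rw [condDensity, Finset.union_comm, hmulWZ]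
    change margDensity ν F W _ * _ / _ = _
    rw [hWx, mul_comm, ENNReal.mul_div_cancel_right h0.ne' h1]
  rw [hcond]
  -- Where f(z | do w) vanishes both integrands vanish; elsewhere f(w,z) = f(w) f(z | do w) ≠ 0 and
  -- `inner` applies.
  rcases eq_or_ne (doDensity ν p W Z (Function.updateFinset x Z y)) 0 with h3 | h3
  · simp [h3]
  · rw [h2]
    rw [hmulWZ]
    exact mul_ne_zero (by rw [hWx]; exact h0.ne') h3

end IsKernelFamily

/-! ### Passage to densities known only almost everywhere. -/

theorem margDensity_ae_congr [∀ i, SigmaFinite (ν i)] {f g : (V → ℂ) → ℝ≥0∞}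
    (hf : Measurable f) (hg : Measurable g) {O : Finset V} (hB : B ⊆ O)
    (h : margDensity ν f O =ᵐ[Measure.pi ν] margDensity ν g O) :
    margDensity ν f B =ᵐ[Measure.pi ν] margDensity ν g B := by
  have e : Bᶜ = O \ B ∪ Oᶜ := by
    ext i
    have := @hB i
    simp only [Finset.mem_compl, Finset.mem_union, Finset.mem_sdiff]
    tauto
  have hd : Disjoint (O \ B) Oᶜ := disjoint_compl_right.mono_left Finset.sdiff_subset
  rw [margDensity, margDensity, e, lmarginal_union ν f hf hd, lmarginal_union ν g hg hd]
  exact lmarginal_ae_congr h _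

theorem frontDoorFormula_ae_congr [∀ i, SigmaFinite (ν i)] {f g : (V → ℂ) → ℝ≥0∞}
    (h : ∀ B ⊆ W ∪ Y ∪ Z, margDensity ν f B =ᵐ[Measure.pi ν] margDensity ν g B) :
    frontDoorFormula ν f W Y Z =ᵐ[Measure.pi ν] frontDoorFormula ν g W Y Z := by
  have sub : W ⊆ W ∪ Y ∪ Z ∧ Z ∪ W ⊆ W ∪ Y ∪ Z ∧ W ∪ Z ⊆ W ∪ Y ∪ Z ∧
      Y ∪ (W ∪ Z) ⊆ W ∪ Y ∪ Z := by
    refine ⟨?_, ?_, ?_, ?_⟩ <;> intro i <;> simp only [Finset.mem_union] <;> tauto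
  obtain ⟨s1, s2, s3, s4⟩ := sub
  refine lmarginal_ae_congr ?_ Z
  have inner : lmarginal ν W (fun x' => condDensity ν f Y (W ∪ Z) x' * margDensity ν f W x')
      =ᵐ[Measure.pi ν]
      lmarginal ν W (fun x' => condDensity ν g Y (W ∪ Z) x' * margDensity ν g W x') := by
    refine lmarginal_ae_congr ?_ W
    filter_upwards [h _ s1, h _ s3, h _ s4] with x h1 h2 h3
    simp only [condDensity, h1, h2, h3]
  filter_upwards [inner, h _ s1, h _ s2] with x h1 h2 h3
  rw [h1]
  simp only [condDensity, h2, h3]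

/-- The front-door adjustment. -/
theorem Factorizes.doDensity_eq_frontDoorFormula [∀ i, SigmaFinite (ν i)]
    {f : (V → ℂ) → ℝ≥0∞} (hf : Factorizes ν G f p) (hG : IsDAG G)
    (hWY : Disjoint W Y) (hWZ : Disjoint W Z) (hZY : Disjoint Z Y) (h : FrontDoor G W Y Z)
    (hpos : ∀ᵐ x ∂(Measure.pi ν), 0 < margDensity ν f W x → 0 < margDensity ν f Z x →
      0 < margDensity ν f (W ∪ Z) x) :
    ∀ᵐ x ∂(Measure.pi ν), 0 < margDensity ν f W x →
      doDensity ν p W Y x = frontDoorFormula ν f W Y Z x := by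
  have hmarg : ∀ B, margDensity ν f B =ᵐ[Measure.pi ν]
      margDensity ν (kernelProd p Finset.univ) B := fun B => lmarginal_ae_congr hf.prod _
  have := hf.isKernelFamily.doDensity_eq_frontDoorFormula hG hWY hWZ hZY h (by
    filter_upwards [hpos, hmarg W, hmarg Z, hmarg (W ∪ Z)] with x h1 h2 h3 h4
    rwa [← h2, ← h3, ← h4])
  filter_upwards [this, hmarg W, frontDoorFormula_ae_congr (W := W) (Y := Y) (Z := Z)
    fun B _ => hmarg B] with x h1 h2 h3
  rwa [h2, h3]

end FrontDoorAdjustment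

theorem mainTheorem5 {V : Type*} [Fintype V] [DecidableEq V]
    {Θ : Type*} [MeasurableSpace Θ] (P : Measure Θ) [IsProbabilityMeasure P]
    -- real stochastic processes with absolutely summable sample paths
    {T : Set ℤ} (X : V → T → Θ → ℝ) (hX : ∀ i t, Measurable (X i t))
    (hl1 : ∀ i θ, Summable fun t => |X i t θ|)
    (ω : ℝ) (hω : ω ∈ Set.Icc 0 (2 * Real.pi))
    -- `f` is the density of the Fourier transforms at `ω` with respect to the product of the `ν i`
    (ν : V → Measure ℂ) [∀ i, SigmaFinite (ν i)]
    (f : (V → ℂ) → ℝ≥0∞) (hf : Measurable f)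
    (hlaw : P.map (freqVec X ω) = (Measure.pi ν).withDensity f)
    -- the density factorizes according to a DAG
    (G : Digraph V) (hG : IsDAG G)
    (p : V → (V → ℂ) → ℝ≥0∞) (hp : Factorizes ν G f p)
    (W Y Z : Finset V) (hWY : Disjoint W Y) (hWZ : Disjoint W Z) (hZY : Disjoint Z Y)
    (hFD : FrontDoor G W Y Z)
    -- the conditional densities in the front-door formula are defined
    (hpos : ∀ᵐ x ∂(Measure.pi ν), 0 < margDensity ν f W x → 0 < margDensity ν f Z x →
      0 < margDensity ν f (W ∪ Z) x) :
    CausalEffectIdentifiable ν G f W Y (W ∪ Y ∪ Z) ∧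
      ∀ᵐ x ∂(Measure.pi ν), 0 < margDensity ν f W x →
        doDensity ν p W Y x = frontDoorFormula ν f W Y Z x := by
  -- Positivity and the front-door formula depend only on marginals inside `W ∪ Y ∪ Z`, so they
  -- transfer between `f` and any model with the same observed marginal. Both claims are instances
  -- of this.
  have key : ∀ (g : (V → ℂ) → ℝ≥0∞) (q : V → (V → ℂ) → ℝ≥0∞), Measurable g →
      Factorizes ν G g q →
      (∀ᵐ x ∂(Measure.pi ν), margDensity ν g (W ∪ Y ∪ Z) x = margDensity ν f (W ∪ Y ∪ Z) x) →
      ∀ᵐ x ∂(Measure.pi ν), 0 < margDensity ν f W x →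
        doDensity ν q W Y x = frontDoorFormula ν f W Y Z x := by
    intro g q hg hq hgf
    have hmarg : ∀ B ⊆ W ∪ Y ∪ Z, margDensity ν g B =ᵐ[Measure.pi ν] margDensity ν f B :=
      fun B hB => margDensity_ae_congr hg hf hB hgf
    have hW : W ⊆ W ∪ Y ∪ Z := fun i hi => by simp [hi]
    have hZ : Z ⊆ W ∪ Y ∪ Z := fun i hi => by simp [hi]
    have := hq.doDensity_eq_frontDoorFormula hG hWY hWZ hZY hFD (by
      filter_upwards [hpos, hmarg W hW, hmarg Z hZ, hmarg (W ∪ Z) (Finset.union_subset hW hZ)]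
        with x h1 h2 h3 h4
      rwa [h2, h3, h4])
    filter_upwards [this, hmarg W hW, frontDoorFormula_ae_congr hmarg] with x h1 h2 h3
    rwa [← h2, ← h3]
  refine ⟨fun f₁ f₂ p₁ p₂ h₁ h₂ hp₁ hp₂ he₁ he₂ => ?_, key f p hf hp (ae_of_all _ fun _ => rfl)⟩
  filter_upwards [key f₁ p₁ h₁ hp₁ he₁, key f₂ p₂ h₂ hp₂ he₂] with x hx₁ hx₂ h
  rw [hx₁ h, hx₂ h]
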